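/- **Theorem 8.1 (coderivative sum rule).** All spaces are real. For a set-valued mapping $F\colon X\rightrightarrows Y$ put $\operatorname{gph}F=\{(x,y): y\in F(x)\}$ and $\operatorname{dom}F=\{x: F(x)\neq\emptyset\}$. For $(\bar x,\bar y)\in\operatorname{gph}F$ and $y^*\in Y^*$ (topological dual), the coderivative is $$D^*F(\bar x,\bar y)(y^*)=\{x^*\in X^*:\ \langle x^*,x-\bar x\rangle-\langle y^*,y-\bar y\rangle\le 0\ \text{ for all }(x,y)\in\operatorname{gph}F\}.$$ Equivalently, $(x^*,-y^*)$ belongs to the normal cone $N((\bar x,\bar y);\operatorname{gph}F)$, where $N(\bar z;\Omega)=\{z^*:\langle z^*,z-\bar z\rangle\le 0\ \forall z\in\Omega\}$. Write $(F_1+F_2)(x)=\{y_1+y_2: y_i\in F_i(x),\ i=1,2\}$ and $\mathbb R^+(\Omega)=\{tv: t>0,\ v\in\Omega\}$. Let $X,Y$ be Hausdorff locally convex topological vector spaces and let $F_1,F_2\colon X\rightrightarrows Y$ have convex graphs. Assume that one of the following conditions holds: (i) $\operatorname{int}(\operatorname{gph}F_1)\ne\emptyset$ and $\operatorname{int}(\operatorname{dom}F_1)\cap\operatorname{dom}F_2\ne\emptyset$;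 (ii) $X$ and $Y$ are Banach spaces, $\operatorname{gph}F_1$ and $\operatorname{gph}F_2$ are closed in $X\times Y$, and $\mathbb R^+(\operatorname{dom}F_1-\operatorname{dom}F_2)$ is a closed linear subspace of $X$. Then for every $(\bar x,\bar y)\in\operatorname{gph}(F_1+F_2)$, every $y^*\in Y^*$ and every pair $(\bar y_1,\bar y_2)$ with $\bar y=\bar y_1+\bar y_2$, $\bar y_1\in F_1(\bar x)$ and $\bar y_2\in F_2(\bar x)$, $$D^*(F_1+F_2)(\bar x,\bar y)(y^*)=D^*F_1(\bar x,\bar y_1)(y^*)+D^*F_2(\bar x,\bar y_2)(y^*).$$ -/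

import Mathlib

open scoped Pointwise

namespace ConvexCoderivative

/-- The graph `gph F = {(x, y) | y ∈ F x}` of a set-valued mapping `F : X ⇉ Y`. -/
def gph {X Y : Type*} (F : X → Set Y) : Set (X × Y) :=
  {p | p.2 ∈ F p.1}

/-- The domain `dom F = {x | F x ≠ ∅}` of a set-valued mapping. -/
def dom {X Y : Type*} (F : X → Set Y) : Set X :=
  {x | (F x).Nonempty}

/-- The sum `(F₁ + F₂)(x) = F₁(x) + F₂(x)` of set-valued mappings. -/
def sumMap {X Y : Type*} [Add Y] (F₁ F₂ : X → Set Y) : X → Set Y :=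
  fun x => {y | ∃ y₁ ∈ F₁ x, ∃ y₂ ∈ F₂ x, y = y₁ + y₂}

/-- The set `S(x, y)` of all splittings `y = y₁ + y₂` with `y₁ ∈ F₁(x)` and `y₂ ∈ F₂(x)`. -/
def splittings {X Y : Type*} [Add Y] (F₁ F₂ : X → Set Y) (x : X) (y : Y) : Set (Y × Y) :=
  {q | y = q.1 + q.2 ∧ q.1 ∈ F₁ x ∧ q.2 ∈ F₂ x}

/-- The normal cone `N(x; Ω)` of convex analysis, a subset of the topological dual
(used for convex `Ω` and `x ∈ Ω`). -/
def normalCone {E : Type*} [AddCommGroup E] [Module ℝ E] [TopologicalSpace E]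
    (x : E) (Ω : Set E) : Set (StrongDual ℝ E) :=
  {φ | ∀ z ∈ Ω, φ (z - x) ≤ 0}

/-- The coderivative `D*F(x, y)(y*) = {x* | (x*, -y*) ∈ N((x, y); gph F)}`. A pair `(x*, v*)`
acts on `X × Y` as the functional `(u, v) ↦ x* u + v* v`, which is `x*.coprod v*`. -/
def coderivative {X Y : Type*} [AddCommGroup X] [Module ℝ X] [TopologicalSpace X]
    [AddCommGroup Y] [Module ℝ Y] [TopologicalSpace Y]
    (F : X → Set Y) (x : X) (y : Y) (yStar : StrongDual ℝ Y) : Set (StrongDual ℝ X) :=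
  {xStar | xStar.coprod (-yStar) ∈ normalCone (x, y) (gph F)}

/-- The cone `ℝ⁺(Ω) = {t v | t > 0, v ∈ Ω}`. -/
def posHull {X : Type*} [AddCommGroup X] [Module ℝ X] (Ω : Set X) : Set X :=
  {x | ∃ t : ℝ, 0 < t ∧ ∃ v ∈ Ω, x = t • v}

/-- The set `A` is a closed linear subspace of `X`. -/
def IsClosedSubspace {X : Type*} [AddCommGroup X] [Module ℝ X] [TopologicalSpace X]
    (A : Set X) : Prop :=
  IsClosed A ∧ ∃ L : Submodule ℝ X, (L : Set X) = A

/-- The coderivative sum rule for `F₁, F₂`: at every point of the graph of `F₁ + F₂`, for every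
`y*` and every splitting. The sum on the right is the Minkowski sum of subsets of `X*`. -/
def CoderivativeSumRule {X Y : Type*} [AddCommGroup X] [Module ℝ X] [TopologicalSpace X]
    [AddCommGroup Y] [Module ℝ Y] [TopologicalSpace Y] (F₁ F₂ : X → Set Y) : Prop :=
  ∀ (x : X) (y : Y), (x, y) ∈ gph (sumMap F₁ F₂) → ∀ (yStar : StrongDual ℝ Y) (y₁ y₂ : Y),
    (y₁, y₂) ∈ splittings F₁ F₂ x y →
      coderivative (sumMap F₁ F₂) x y yStar =
        coderivative F₁ x y₁ yStar + coderivative F₂ x y₂ yStar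

end ConvexCoderivative

/-! The inclusion from right to left adds two inequalities. For the other, relax the constraint that
both graph points share a first coordinate: let φ(d) be the infimum of y*(v - y₁) + y*(z - y₂) -
x*(u - x) over (u, v) ∈ gph F₁, (w, z) ∈ gph F₂ with u - w = d. Then φ is convex, and x* in the
coderivative of the sum means φ(0) ≥ 0. If a continuous linear a lies below φ, fixing one graph
point at its reference value shows that x* = (x* + a) + (-a) is the required splitting.

Such an a comes from separating (0, 0) from the interior of the epigraph of φ; the hyperplane is not
vertical because φ is defined near 0. Under (i) the interior of gph F₁ makes the epigraph solid.
Under (ii) φ lives on the closed subspace L, is bounded above near 0 by Robinson–Ursescu, and a is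
extended from L by Hahn–Banach. -/

namespace ConvexCoderivative

/-! ### Non-vertical separation -/

/-- A convex epigraph-like set with nonempty interior, whose projection is a neighbourhood of the
origin and which lies above `0` over the origin, lies above a continuous linear functional. -/
theorem exists_strongDual_le_of_epigraph {V : Type*} [AddCommGroup V] [Module ℝ V]
    [TopologicalSpace V] [IsTopologicalAddGroup V] [ContinuousSMul ℝ V]
    {S : Set (V × ℝ)} (hS : Convex ℝ S)
    (hup : ∀ d s t, (d, s) ∈ S → s ≤ t → (d, t) ∈ S)
    (hint : (interior S).Nonempty) (hdom : Prod.fst '' S ∈ nhds (0 : V))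
    (hzero : ∀ t, ((0 : V), t) ∈ S → 0 ≤ t) :
    ∃ a : StrongDual ℝ V, ∀ d t, (d, t) ∈ S → a d ≤ t := by
  have h0 : ((0 : V), (0 : ℝ)) ∉ interior S := by
    intro h
    have hS0 : S ∈ nhds ((0 : V), (0 : ℝ)) := mem_interior_iff_mem_nhds.1 h
    have hc : ContinuousAt (fun t : ℝ => ((0 : V), t)) 0 := by fun_prop
    obtain ⟨ε, hε, hb⟩ := Metric.mem_nhds_iff.1 (hc.preimage_mem_nhds hS0)
    have hmem : ((0 : V), -(ε / 2)) ∈ S := by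
      refine hb (a := -(ε / 2)) ?_
      rw [Metric.mem_ball, Real.dist_eq, sub_zero, abs_neg, abs_of_pos (by positivity)]
      linarith
    have := hzero _ hmem
    linarith
  obtain ⟨f, hf⟩ := geometric_hahn_banach_open_point hS.interior isOpen_interior h0
  have hf0 : f ((0 : V), (0 : ℝ)) = 0 := f.map_zero
  rw [hf0] at hf
  have hle : ∀ p ∈ S, f p ≤ 0 := by
    intro p hp
    have hpc : p ∈ closure (interior S) := by
      rw [hS.closure_interior_eq_closure_of_nonempty_interior hint]
      exact subset_closure hp
    exact closure_minimal (fun q hq => (hf q hq).le)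
      (isClosed_le f.continuous continuous_const) hpc
  set g : StrongDual ℝ V := f.comp (ContinuousLinearMap.inl ℝ V ℝ) with hg
  set β : ℝ := f (0, 1) with hβ
  have hdec : ∀ d t, f (d, t) = g d + t * β := by
    intro d t
    have : ((d, t) : V × ℝ) = (d, 0) + t • ((0 : V), (1 : ℝ)) := by simp
    rw [this, map_add, map_smul, smul_eq_mul]
    simp [hg, hβ]
  obtain ⟨⟨d₀, t₀⟩, hp₀, -⟩ := mem_of_mem_nhds hdom
  have hβle : β ≤ 0 := by
    by_contra! hpos
    have h1 := hle _ (hup d₀ t₀ (max t₀ ((1 - g d₀) / β)) hp₀ (le_max_left _ _))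
    rw [hdec] at h1
    have h2 : (1 - g d₀) / β * β ≤ max t₀ ((1 - g d₀) / β) * β :=
      mul_le_mul_of_nonneg_right (le_max_right _ _) hpos.le
    rw [div_mul_cancel₀ _ hpos.ne'] at h2
    linarith
  -- A vertical hyperplane would give `g ≤ 0` on an absorbing set, hence `g = 0`, against `f < 0` on
  -- the interior.
  have hβne : β ≠ 0 := by
    intro hb
    have hg0 : ∀ v, g v ≤ 0 := by
      intro v
      have hc : ContinuousAt (fun s : ℝ => s • v) 0 := by fun_prop
      have hn : (fun s : ℝ => s • v) ⁻¹' (Prod.fst '' S) ∈ nhds (0 : ℝ) :=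
        hc.preimage_mem_nhds (by simpa using hdom)
      obtain ⟨ε, hε, hb'⟩ := Metric.mem_nhds_iff.1 hn
      have hmem : (ε / 2) ∈ Metric.ball (0 : ℝ) ε := by
        rw [Metric.mem_ball, Real.dist_eq, sub_zero, abs_of_pos (by positivity)]
        linarith
      obtain ⟨⟨d, t⟩, hp, hd⟩ := hb' hmem
      have h1 := hle _ hp
      rw [hdec, hb] at h1
      simp only at hd
      rw [hd, map_smul, smul_eq_mul] at h1
      nlinarith
    obtain ⟨⟨d, t⟩, hp⟩ := hint
    have h1 := hf _ hp
    rw [hdec, hb] at h1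
    have h2 := hg0 (-d)
    rw [map_neg] at h2
    linarith
  have hβneg : 0 < -β := by
    have := lt_of_le_of_ne hβle hβne
    linarith
  refine ⟨(-β)⁻¹ • g, fun d t hp => ?_⟩
  have h1 := hle _ hp
  rw [hdec] at h1
  change (-β)⁻¹ * g d ≤ t
  rw [inv_mul_le_iff₀ hβneg]
  linarith

/-! ### The Robinson–Ursescu theorem -/

/-- Baire category half of the Robinson–Ursescu theorem: a convex set containing the origin whose
positive dilates exhaust a complete space is dense in a neighbourhood of the origin. -/
theorem closure_mem_nhds_zero_of_absorbing {V : Type*} [NormedAddCommGroup V] [NormedSpace ℝ V]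
    [CompleteSpace V] {D : Set V} (hD : Convex ℝ D)
    (habs : ∀ v : V, ∃ n : ℕ, ∃ e ∈ D, v = ((n : ℝ) + 1) • e) :
    closure D ∈ nhds (0 : V) := by
  have hne : ∀ n : ℕ, ((n : ℝ) + 1) ≠ 0 := fun n => by positivity
  have hU : ⋃ n : ℕ, ((n : ℝ) + 1) • closure D = Set.univ := by
    refine Set.eq_univ_of_forall fun v => ?_
    obtain ⟨n, e, he, rfl⟩ := habs v
    exact Set.mem_iUnion.2 ⟨n, Set.smul_mem_smul_set (subset_closure he)⟩
  obtain ⟨n, hn⟩ := nonempty_interior_of_iUnion_of_closed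
    (fun n : ℕ => isClosed_closure.smul_of_ne_zero (hne n)) hU
  rw [interior_smul₀ (hne n)] at hn
  obtain ⟨z, hz⟩ := Set.smul_set_nonempty.1 hn
  -- As -z = (m + 1)e, the origin is a convex combination of the interior point z and of e, so it is
  -- interior too.
  obtain ⟨m, e, he, hze⟩ := habs (-z)
  have hm : (0 : ℝ) < (m : ℝ) + 1 := by positivity
  have hmem := hD.closure.combo_interior_self_mem_interior hz (subset_closure he)
    (a := 1 / ((m : ℝ) + 2)) (b := ((m : ℝ) + 1) / ((m : ℝ) + 2))
    (by positivity) (by positivity) (by field_simp; ring)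
  have h0 : (1 / ((m : ℝ) + 2)) • z + (((m : ℝ) + 1) / ((m : ℝ) + 2)) • e = 0 := by
    rw [div_eq_inv_mul ((m : ℝ) + 1), mul_smul, ← hze, one_div, smul_neg, add_neg_cancel]
  rw [h0] at hmem
  exact mem_interior_iff_mem_nhds.1 hmem

/-- Robinson–Ursescu theorem at the origin: a closed convex relation between Banach spaces whose
range is absorbing maps the unit ball onto a neighbourhood of the origin. -/
theorem exists_ball_subset_image_of_closed_convex {E V : Type*}
    [NormedAddCommGroup E] [NormedSpace ℝ E] [CompleteSpace E]
    [NormedAddCommGroup V] [NormedSpace ℝ V] [CompleteSpace V]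
    {G : Set (E × V)} (hconv : Convex ℝ G) (hclosed : IsClosed G) (hzero : (0, 0) ∈ G)
    (habs : ∀ v : V, ∃ t : ℝ, 0 < t ∧ ∃ p ∈ G, v = t • p.2) :
    ∃ r > 0, ∀ v : V, ‖v‖ < r → ∃ c : E, ‖c‖ ≤ 1 ∧ (c, v) ∈ G := by
  set D : Set V := {v | ∃ c : E, ‖c‖ ≤ 1 ∧ (c, v) ∈ G} with hDdef
  have hscale : ∀ (p : E × V), p ∈ G → ∀ s : ℝ, 0 ≤ s → s ≤ 1 → s • p ∈ G :=
    fun p hp s hs0 hs1 => hconv.smul_mem_of_zero_mem hzero hp ⟨hs0, hs1⟩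
  have hD : Convex ℝ D := by
    rintro v ⟨c, hc, hcv⟩ w ⟨d, hd, hdw⟩ a b ha hb hab
    refine ⟨a • c + b • d, ?_, hconv hcv hdw ha hb hab⟩
    have := convex_closedBall (0 : E) 1 (mem_closedBall_zero_iff.2 hc)
      (mem_closedBall_zero_iff.2 hd) ha hb hab
    exact mem_closedBall_zero_iff.1 this
  have hDabs : ∀ v : V, ∃ n : ℕ, ∃ e ∈ D, v = ((n : ℝ) + 1) • e := by
    intro v
    obtain ⟨t, ht, ⟨c, e⟩, hp, rfl⟩ := habs v
    obtain ⟨n, hn⟩ := exists_nat_ge (max t (t * ‖c‖))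
    have hn1 : t ≤ n := (le_max_left _ _).trans hn
    have hn2 : t * ‖c‖ ≤ n := (le_max_right _ _).trans hn
    have hpos : (0 : ℝ) < (n : ℝ) + 1 := by positivity
    refine ⟨n, (t / (n + 1)) • e, ⟨(t / (n + 1)) • c, ?_, ?_⟩, ?_⟩
    · rw [norm_smul, Real.norm_of_nonneg (by positivity), div_mul_eq_mul_div,
        div_le_one hpos]
      linarith
    · exact hscale _ hp _ (by positivity) ((div_le_one hpos).2 (by linarith))
    · rw [smul_smul, mul_div_cancel₀ _ hpos.ne']
  obtain ⟨r, hr, hball⟩ := Metric.mem_nhds_iff.1 (closure_mem_nhds_zero_of_absorbing hD hDabs)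
  -- Doubling the error and correcting it to within r / 2 returns to the same ball, so the step can
  -- be iterated.
  have hstep : ∀ e : V, ‖e‖ < r / 2 → ∃ p : E × V, p ∈ G ∧ ‖p.1‖ ≤ 1 ∧
      ‖(2 : ℝ) • e - p.2‖ < r / 2 := by
    intro e he
    have hmem : (2 : ℝ) • e ∈ closure D := by
      apply hball
      rw [mem_ball_zero_iff, norm_smul, Real.norm_of_nonneg (by norm_num)]
      linarith
    obtain ⟨w, ⟨c, hc, hcw⟩, hd⟩ := Metric.mem_closure_iff.1 hmem (r / 2) (by positivity)
    exact ⟨(c, w), hcw, hc, by rwa [dist_eq_norm] at hd⟩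
  choose! p hpG hp1 hp2 using hstep
  refine ⟨r / 2, by positivity, fun v hv => ?_⟩
  -- `e n` is the error of the n-th partial sum, magnified by 2ⁿ.
  let e : ℕ → V := fun n => Nat.rec v (fun _ x => (2 : ℝ) • x - (p x).2) n
  have he_succ : ∀ n, e (n + 1) = (2 : ℝ) • e n - (p (e n)).2 := fun n => rfl
  have he : ∀ n, ‖e n‖ < r / 2 := by
    intro n
    induction n with
    | zero => exact hv
    | succ n ih => rw [he_succ]; exact hp2 _ ih
  let s : ℕ → E × V := fun n => ∑ k ∈ Finset.range n, ((1 / 2 : ℝ) ^ (k + 1)) • p (e k)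
  have hs_succ : ∀ n, s (n + 1) = s n + ((1 / 2 : ℝ) ^ (n + 1)) • p (e n) :=
    fun n => Finset.sum_range_succ _ _
  -- The weights in `s n` add up to 1 - 2⁻ⁿ; the missing mass may go to any point of `G`. This
  -- stronger form makes the induction work, and the origin then gives `s n ∈ G`.
  have hs_mem : ∀ n, ∀ q ∈ G, s n + ((1 / 2 : ℝ) ^ n) • q ∈ G := by
    intro n
    induction n with
    | zero => intro q hq; simpa [s] using hq
    | succ n ih =>
      intro q hq
      have := ih _ (hconv (hpG _ (he n)) hq (a := 1 / 2) (b := 1 / 2) (by norm_num)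
        (by norm_num) (by norm_num))
      convert this using 1
      rw [hs_succ, smul_add, smul_smul, smul_smul, ← pow_succ, add_assoc]
  have hsG : ∀ n, s n ∈ G := fun n => by
    simpa only [Prod.mk_zero_zero, smul_zero, add_zero] using hs_mem n (0, 0) hzero
  have hs2 : ∀ n, (s n).2 = v - ((1 / 2 : ℝ) ^ n) • e n := by
    intro n
    induction n with
    | zero => simp [s, e]
    | succ n ih =>
      rw [hs_succ, Prod.snd_add, ih, he_succ, Prod.smul_snd, smul_sub, smul_smul]
      have : (1 / 2 : ℝ) ^ (n + 1) * 2 = (1 / 2 : ℝ) ^ n := by rw [pow_succ]; ring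
      rw [this]
      abel
  have hgeom : Filter.Tendsto (fun n : ℕ => (1 / 2 : ℝ) ^ n) Filter.atTop (nhds 0) :=
    tendsto_pow_atTop_nhds_zero_of_lt_one (by norm_num) (by norm_num)
  have hlim2 : Filter.Tendsto (fun n => (s n).2) Filter.atTop (nhds v) := by
    have h0 : Filter.Tendsto (fun n => ((1 / 2 : ℝ) ^ n) • e n) Filter.atTop (nhds 0) := by
      refine squeeze_zero_norm (a := fun n => (1 / 2 : ℝ) ^ n * (r / 2)) (fun n => ?_) ?_
      · rw [norm_smul, Real.norm_of_nonneg (by positivity)]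
        exact mul_le_mul_of_nonneg_left (he n).le (by positivity)
      · simpa using hgeom.mul_const (r / 2)
    simp only [hs2]
    simpa using tendsto_const_nhds.sub h0
  have hterm : ∀ k, ‖((1 / 2 : ℝ) ^ (k + 1)) • (p (e k)).1‖ ≤ (1 / 2 : ℝ) ^ (k + 1) := by
    intro k
    rw [norm_smul, Real.norm_of_nonneg (by positivity)]
    exact mul_le_of_le_one_right (by positivity) (hp1 _ (he k))
  have hs1 : ∀ n, (s n).1 = ∑ k ∈ Finset.range n, ((1 / 2 : ℝ) ^ (k + 1)) • (p (e k)).1 :=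
    fun n => by simp [s, Prod.fst_sum]
  have hgs : HasSum (fun k : ℕ => (1 / 2 : ℝ) ^ (k + 1)) 1 := by
    have := hasSum_geometric_two.mul_right (1 / 2 : ℝ)
    simpa [pow_succ] using this
  have hsum : Summable fun k => ((1 / 2 : ℝ) ^ (k + 1)) • (p (e k)).1 :=
    Summable.of_norm_bounded hgs.summable hterm
  have hlim1 : Filter.Tendsto (fun n => (s n).1) Filter.atTop
      (nhds (∑' k, ((1 / 2 : ℝ) ^ (k + 1)) • (p (e k)).1)) := by
    simp only [hs1]
    exact hsum.hasSum.tendsto_sum_nat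
  refine ⟨_, tsum_of_norm_bounded hgs hterm, ?_⟩
  exact hclosed.mem_of_tendsto (hlim1.prodMk_nhds hlim2) (Filter.Eventually.of_forall hsG)

/-! ### The value function and the interiority case -/

section SumRule

variable {X Y : Type*} [AddCommGroup X] [Module ℝ X] [TopologicalSpace X]
  [AddCommGroup Y] [Module ℝ Y] [TopologicalSpace Y]

theorem mem_coderivative_iff {F : X → Set Y} {x : X} {y : Y} {yStar : StrongDual ℝ Y}
    {xStar : StrongDual ℝ X} :
    xStar ∈ coderivative F x y yStar ↔
      ∀ u v, (u, v) ∈ gph F → xStar (u - x) ≤ yStar (v - y) := by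
  constructor
  · intro h u v huv
    have h1 : xStar (u - x) + -yStar (v - y) ≤ 0 := h (u, v) huv
    linarith
  · rintro h ⟨u, v⟩ huv
    change xStar (u - x) + -yStar (v - y) ≤ 0
    linarith [h u v huv]

theorem coderivative_add_subset [IsTopologicalAddGroup X] {F₁ F₂ : X → Set Y} {x : X} {y₁ y₂ : Y}
    {yStar : StrongDual ℝ Y} :
    coderivative F₁ x y₁ yStar + coderivative F₂ x y₂ yStar ⊆
      coderivative (sumMap F₁ F₂) x (y₁ + y₂) yStar := by
  rintro _ ⟨a, ha, b, hb, rfl⟩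
  rw [mem_coderivative_iff] at ha hb ⊢
  rintro u _ ⟨v₁, hv₁, v₂, hv₂, rfl⟩
  have h1 := ha u v₁ hv₁
  have h2 := hb u v₂ hv₂
  rw [add_sub_add_comm, map_add]
  exact add_le_add h1 h2

/-- The epigraph of the value function `d ↦ inf (y*(v - y₁) + y*(z - y₂) - x*(u - x))`, the
infimum being over `(u, v) ∈ gph F₁` and `(w, z) ∈ gph F₂` with `u - w = j d`. -/
def valueEpigraph {V : Type*} [AddCommGroup V] [Module ℝ V] (j : V →ₗ[ℝ] X) (F₁ F₂ : X → Set Y)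
    (x : X) (y₁ y₂ : Y) (yStar : StrongDual ℝ Y) (xStar : StrongDual ℝ X) : Set (V × ℝ) :=
  {p | ∃ u v w z, (u, v) ∈ gph F₁ ∧ (w, z) ∈ gph F₂ ∧ u - w = j p.1 ∧
    yStar (v - y₁) + yStar (z - y₂) - xStar (u - x) ≤ p.2}

theorem convex_valueEpigraph {V : Type*} [AddCommGroup V] [Module ℝ V] (j : V →ₗ[ℝ] X)
    {F₁ F₂ : X → Set Y} (h₁ : Convex ℝ (gph F₁)) (h₂ : Convex ℝ (gph F₂)) (x : X) (y₁ y₂ : Y)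
    (yStar : StrongDual ℝ Y) (xStar : StrongDual ℝ X) :
    Convex ℝ (valueEpigraph j F₁ F₂ x y₁ y₂ yStar xStar) := by
  rintro ⟨d, s⟩ ⟨u, v, w, z, huv, hwz, hd, hs⟩ ⟨d', s'⟩ ⟨u', v', w', z', huv', hwz', hd', hs'⟩
    a b ha hb hab
  refine ⟨_, _, _, _, h₁ huv huv' ha hb hab, h₂ hwz hwz' ha hb hab, ?_, ?_⟩
  · change (a • u + b • u') - (a • w + b • w') = j (a • d + b • d')
    rw [map_add, map_smul, map_smul, ← hd, ← hd', smul_sub, smul_sub]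
    abel
  · change yStar (a • v + b • v' - y₁) + yStar (a • z + b • z' - y₂)
      - xStar (a • u + b • u' - x) ≤ a * s + b * s'
    simp only [map_sub, map_add, map_smul, smul_eq_mul] at hs hs' ⊢
    have e := add_le_add (mul_le_mul_of_nonneg_left hs ha) (mul_le_mul_of_nonneg_left hs' hb)
    have hb' : b = 1 - a := by linarith
    subst hb'
    linarith

/-- A functional below the value function, extended to the whole space, splits any element of the
coderivative of the sum. -/
theorem mem_coderivative_add_of_le_valueEpigraph {V : Type*} [AddCommGroup V] [Module ℝ V]
    [IsTopologicalAddGroup X] [ContinuousSMul ℝ X]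
    {j : V →ₗ[ℝ] X} {F₁ F₂ : X → Set Y} {x : X} {y₁ y₂ : Y} {yStar : StrongDual ℝ Y}
    {xStar : StrongDual ℝ X} (hy₁ : (x, y₁) ∈ gph F₁) (hy₂ : (x, y₂) ∈ gph F₂)
    (hj : ∀ u ∈ dom F₁, ∀ w ∈ dom F₂, u - w ∈ LinearMap.range j) (a : StrongDual ℝ X)
    (ha : ∀ d t, (d, t) ∈ valueEpigraph j F₁ F₂ x y₁ y₂ yStar xStar → a (j d) ≤ t) :
    xStar ∈ coderivative F₁ x y₁ yStar + coderivative F₂ x y₂ yStar := by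
  have key : ∀ u v w z, (u, v) ∈ gph F₁ → (w, z) ∈ gph F₂ →
      a (u - w) ≤ yStar (v - y₁) + yStar (z - y₂) - xStar (u - x) := by
    intro u v w z huv hwz
    obtain ⟨d, hd⟩ := hj u ⟨v, huv⟩ w ⟨z, hwz⟩
    rw [← hd]
    exact ha _ _ ⟨u, v, w, z, huv, hwz, hd.symm, le_rfl⟩
  refine ⟨xStar + a, ?_, -a, ?_, by simp⟩
  · rw [mem_coderivative_iff]
    intro u v huv
    have h := key u v x y₂ huv hy₂
    rw [sub_self, map_zero] at h
    change xStar (u - x) + a (u - x) ≤ _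
    linarith
  · rw [mem_coderivative_iff]
    intro w z hwz
    have h := key x y₁ w z hy₁ hwz
    rw [sub_self, sub_self, map_zero, map_zero, ← neg_sub w x, map_neg] at h
    change -a (w - x) ≤ _
    linarith

theorem exists_strongDual_le_valueEpigraph {V : Type*} [AddCommGroup V] [Module ℝ V]
    [TopologicalSpace V] [IsTopologicalAddGroup V] [ContinuousSMul ℝ V] {j : V →ₗ[ℝ] X}
    {F₁ F₂ : X → Set Y} (h₁ : Convex ℝ (gph F₁)) (h₂ : Convex ℝ (gph F₂)) {x : X} {y₁ y₂ : Y}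
    {yStar : StrongDual ℝ Y} {xStar : StrongDual ℝ X}
    (hx : xStar ∈ coderivative (sumMap F₁ F₂) x (y₁ + y₂) yStar)
    (hint : (interior (valueEpigraph j F₁ F₂ x y₁ y₂ yStar xStar)).Nonempty)
    (hdom : Prod.fst '' valueEpigraph j F₁ F₂ x y₁ y₂ yStar xStar ∈ nhds (0 : V)) :
    ∃ a : StrongDual ℝ V,
      ∀ d t, (d, t) ∈ valueEpigraph j F₁ F₂ x y₁ y₂ yStar xStar → a d ≤ t := by
  refine exists_strongDual_le_of_epigraph (convex_valueEpigraph j h₁ h₂ x y₁ y₂ yStar xStar)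
    ?_ hint hdom ?_
  · rintro d s t ⟨u, v, w, z, huv, hwz, hd, hs⟩ hst
    exact ⟨u, v, w, z, huv, hwz, hd, hs.trans hst⟩
  -- Over d = 0 the two first coordinates agree, so v + z is a value of the sum at u.
  · rintro t ⟨u, v, w, z, huv, hwz, hd, hs⟩
    rw [map_zero, sub_eq_zero] at hd
    subst hd
    have h := mem_coderivative_iff.1 hx u (v + z) ⟨v, huv, z, hwz, rfl⟩
    rw [add_sub_add_comm, map_add] at h
    change _ ≤ t at hs
    linarith

theorem coderivativeSumRule_of_subset [IsTopologicalAddGroup X] {F₁ F₂ : X → Set Y}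
    (h : ∀ x y₁ y₂ (yStar : StrongDual ℝ Y), (x, y₁) ∈ gph F₁ → (x, y₂) ∈ gph F₂ →
      ∀ xStar ∈ coderivative (sumMap F₁ F₂) x (y₁ + y₂) yStar,
        xStar ∈ coderivative F₁ x y₁ yStar + coderivative F₂ x y₂ yStar) :
    CoderivativeSumRule F₁ F₂ := by
  rintro x _ - yStar y₁ y₂ ⟨rfl, hy₁, hy₂⟩
  exact Set.Subset.antisymm (h x y₁ y₂ yStar hy₁ hy₂) coderivative_add_subset

theorem coderivativeSumRule_of_interior [IsTopologicalAddGroup X] [ContinuousSMul ℝ X]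
    {F₁ F₂ : X → Set Y} (h₁ : Convex ℝ (gph F₁)) (h₂ : Convex ℝ (gph F₂))
    (hint : (interior (gph F₁)).Nonempty) (hdom : (interior (dom F₁) ∩ dom F₂).Nonempty) :
    CoderivativeSumRule F₁ F₂ := by
  refine coderivativeSumRule_of_subset fun x y₁ y₂ yStar hy₁ hy₂ xStar hx => ?_
  obtain ⟨⟨u₀, v₀⟩, huv₀⟩ := hint
  obtain ⟨w, hw₁, z, hwz⟩ := hdom
  suffices h : ∃ a : StrongDual ℝ X,
      ∀ d t, (d, t) ∈ valueEpigraph LinearMap.id F₁ F₂ x y₁ y₂ yStar xStar → a d ≤ t by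
    obtain ⟨a, ha⟩ := h
    exact mem_coderivative_add_of_le_valueEpigraph hy₁ hy₂ (by simp) a ha
  refine exists_strongDual_le_valueEpigraph h₁ h₂ hx ?_ ?_
  -- With w, z and v₀ frozen, the objective is continuous in d, so lying strictly above it is an
  -- open condition.
  · let U : Set (X × ℝ) := {p | (w + p.1, v₀) ∈ interior (gph F₁)} ∩
      {p | yStar (v₀ - y₁) + yStar (z - y₂) - xStar (w + p.1 - x) < p.2}
    have hU : IsOpen U :=
      (isOpen_interior.preimage (by fun_prop)).inter (isOpen_lt (by fun_prop) (by fun_prop))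
    refine ⟨(u₀ - w, yStar (v₀ - y₁) + yStar (z - y₂) - xStar (u₀ - x) + 1),
      interior_maximal ?_ hU ⟨?_, ?_⟩⟩
    · rintro ⟨d, t⟩ ⟨hd, ht⟩
      exact ⟨w + d, v₀, w, z, interior_subset hd, hwz, by simp, ht.le⟩
    · simpa using huv₀
    · simp
  · have hc : ContinuousAt (fun d : X => w + d) 0 := by fun_prop
    have hn : (fun d : X => w + d) ⁻¹' dom F₁ ∈ nhds (0 : X) :=
      hc.preimage_mem_nhds (by simpa using mem_interior_iff_mem_nhds.1 hw₁)
    filter_upwards [hn] with d hd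
    obtain ⟨v, hv⟩ := hd
    exact ⟨(d, _), ⟨w + d, v, w, z, hv, hwz, by simp, le_rfl⟩, rfl⟩

end SumRule

/-! ### The Banach space case -/

theorem coderivativeSumRule_of_isClosed {X Y : Type*}
    [NormedAddCommGroup X] [NormedSpace ℝ X] [CompleteSpace X]
    [NormedAddCommGroup Y] [NormedSpace ℝ Y] [CompleteSpace Y]
    {F₁ F₂ : X → Set Y} (h₁ : Convex ℝ (gph F₁)) (h₂ : Convex ℝ (gph F₂))
    (hc₁ : IsClosed (gph F₁)) (hc₂ : IsClosed (gph F₂))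
    (hL : IsClosedSubspace (posHull (dom F₁ - dom F₂))) :
    CoderivativeSumRule F₁ F₂ := by
  obtain ⟨hLc, L, hLeq⟩ := hL
  rw [← hLeq] at hLc
  have : CompleteSpace L := hLc.completeSpace_coe
  have hmem : ∀ u ∈ dom F₁, ∀ w ∈ dom F₂, u - w ∈ L := by
    intro u hu w hw
    rw [← SetLike.mem_coe, hLeq]
    exact ⟨1, one_pos, u - w, Set.sub_mem_sub hu hw, (one_smul _ _).symm⟩
  refine coderivativeSumRule_of_subset fun x y₁ y₂ yStar hy₁ hy₂ xStar hx => ?_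
  -- Graph points are recorded as displacements from the reference points, so that the origin lies
  -- in `G` and the unit ball bounds the displacements.
  let G : Set (((X × Y) × (X × Y)) × L) := {q | (x, y₁) + q.1.1 ∈ gph F₁ ∧
    (x, y₂) + q.1.2 ∈ gph F₂ ∧ q.1.1.1 - q.1.2.1 = (q.2 : X)}
  have hGconv : Convex ℝ G := by
    rintro p ⟨hp₁, hp₂, hp₃⟩ q ⟨hq₁, hq₂, hq₃⟩ a b ha hb hab
    refine ⟨?_, ?_, ?_⟩
    · have := h₁ hp₁ hq₁ ha hb hab
      rwa [smul_add, smul_add, add_add_add_comm, ← add_smul, hab, one_smul] at this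
    · have := h₂ hp₂ hq₂ ha hb hab
      rwa [smul_add, smul_add, add_add_add_comm, ← add_smul, hab, one_smul] at this
    · change (a • p.1.1.1 + b • q.1.1.1) - (a • p.1.2.1 + b • q.1.2.1) =
        a • (p.2 : X) + b • (q.2 : X)
      rw [← hp₃, ← hq₃, smul_sub, smul_sub]
      abel
  have hGclosed : IsClosed G :=
    (hc₁.preimage (by fun_prop)).inter
      ((hc₂.preimage (by fun_prop)).inter (isClosed_eq (by fun_prop) (by fun_prop)))
  have hGabs : ∀ v : L, ∃ t : ℝ, 0 < t ∧ ∃ p ∈ G, v = t • p.2 := by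
    intro v
    have hv : (v : X) ∈ posHull (dom F₁ - dom F₂) := by
      rw [← hLeq]
      exact v.2
    obtain ⟨t, ht, _, ⟨u, ⟨y, hy⟩, w, ⟨z, hz⟩, rfl⟩, hv⟩ := hv
    refine ⟨t, ht, (((u - x, y - y₁), (w - x, z - y₂)),
      ⟨u - w, hmem u ⟨y, hy⟩ w ⟨z, hz⟩⟩), ⟨?_, ?_, ?_⟩, Subtype.ext hv⟩
    · simpa [gph] using hy
    · simpa [gph] using hz
    · simp
  obtain ⟨r, hr, hball⟩ := exists_ball_subset_image_of_closed_convex hGconv hGclosed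
    (by simpa [G] using And.intro hy₁ hy₂) hGabs
  set S := valueEpigraph L.subtype F₁ F₂ x y₁ y₂ yStar xStar with hS
  set M : ℝ := ‖yStar‖ + ‖yStar‖ + ‖xStar‖ with hM
  -- Displacements of norm at most 1 keep the objective below `M`, so φ ≤ `M` on the ball.
  have hsub : Metric.ball (0 : L) r ×ˢ Set.Ioi M ⊆ S := by
    rintro ⟨d, t⟩ ⟨hd, ht⟩
    obtain ⟨⟨⟨u, v⟩, ⟨w, z⟩⟩, hc, hp₁, hp₂, hp₃⟩ := hball d (mem_ball_zero_iff.1 hd)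
    simp only [Prod.norm_mk, sup_le_iff] at hc
    obtain ⟨⟨hu, hv⟩, -, hz⟩ := hc
    refine ⟨x + u, y₁ + v, x + w, y₂ + z, hp₁, hp₂, ?_, ?_⟩
    · rw [add_sub_add_left_eq_sub]
      exact hp₃
    · rw [add_sub_cancel_left, add_sub_cancel_left, add_sub_cancel_left]
      have e₁ := (le_abs_self _).trans (yStar.unit_le_opNorm v hv)
      have e₂ := (le_abs_self _).trans (yStar.unit_le_opNorm z hz)
      have e₃ := (neg_le_abs _).trans (xStar.unit_le_opNorm u hu)
      have ht' : M < t := ht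
      change _ ≤ t
      linarith
  have hzero : (0 : L) ∈ Metric.ball (0 : L) r := Metric.mem_ball_self hr
  have hM1 : M + 1 ∈ Set.Ioi M := lt_add_one M
  obtain ⟨a, ha⟩ := exists_strongDual_le_valueEpigraph (j := L.subtype) h₁ h₂ hx
    ⟨(0, M + 1), interior_maximal hsub (Metric.isOpen_ball.prod isOpen_Ioi) ⟨hzero, hM1⟩⟩
    (Filter.mem_of_superset (Metric.ball_mem_nhds 0 hr)
      fun d hd => ⟨(d, M + 1), hsub ⟨hd, hM1⟩, rfl⟩)
  obtain ⟨b, hb, -⟩ := exists_extension_norm_eq L a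
  refine mem_coderivative_add_of_le_valueEpigraph (j := L.subtype) hy₁ hy₂ ?_ b ?_
  · simpa using hmem
  · intro d t hdt
    exact (hb d).trans_le (ha d t hdt)

end ConvexCoderivative

open ConvexCoderivative in
theorem theorem8p1 :
    -- (i) the interiority condition, in separated locally convex spaces
    (∀ (X : Type*) (Y : Type*)
      [AddCommGroup X] [Module ℝ X] [TopologicalSpace X] [IsTopologicalAddGroup X]
      [ContinuousSMul ℝ X] [LocallyConvexSpace ℝ X] [T2Space X]
      [AddCommGroup Y] [Module ℝ Y] [TopologicalSpace Y] [IsTopologicalAddGroup Y]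
      [ContinuousSMul ℝ Y] [LocallyConvexSpace ℝ Y] [T2Space Y]
      (F₁ F₂ : X → Set Y),
      Convex ℝ (gph F₁) → Convex ℝ (gph F₂) →
      (interior (gph F₁)).Nonempty → (interior (dom F₁) ∩ dom F₂).Nonempty →
      CoderivativeSumRule F₁ F₂) ∧
    -- (ii) the closedness and subspace condition, in Banach spaces
    (∀ (X : Type*) (Y : Type*)
      [NormedAddCommGroup X] [NormedSpace ℝ X] [CompleteSpace X]
      [NormedAddCommGroup Y] [NormedSpace ℝ Y] [CompleteSpace Y]
      (F₁ F₂ : X → Set Y),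
      Convex ℝ (gph F₁) → Convex ℝ (gph F₂) →
      IsClosed (gph F₁) → IsClosed (gph F₂) →
      IsClosedSubspace (posHull (dom F₁ - dom F₂)) →
      CoderivativeSumRule F₁ F₂) := by
  refine ⟨?_, ?_⟩
  · intro X Y _ _ _ _ _ _ _ _ _ _ _ _ _ _ F₁ F₂ h₁ h₂ hint hdom
    exact coderivativeSumRule_of_interior h₁ h₂ hint hdom
  · intro X Y _ _ _ _ _ _ F₁ F₂ h₁ h₂ hc₁ hc₂ hL
    exact coderivativeSumRule_of_isClosed h₁ h₂ hc₁ hc₂ hL
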